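/- For a group $H$ let $\gamma_1(H)=H$, $\gamma_{n+1}(H)=[\gamma_n(H),H]$ be its lower central series, and let $D_n(H)=\{g\in H : g-1\in \mathfrak h^n\}$ be its dimension subgroups, where $\mathfrak h$ is the augmentation ideal of $\mathbb Z[H]$. For a group $G$ let $\mathsf{Pres}(G)$ be the category whose objects are the free presentations of $G$, i.e. epimorphisms $\pi\colon F\twoheadrightarrow G$ from free groups $F$ (with $R=\ker\pi$), and whose morphisms are the group homomorphisms over $G$. Both $\frac{R\cap\gamma_2(F)}{\gamma_2(R)(R\cap\gamma_4(F))}$ and $\frac{\gamma_2(F)}{\gamma_2(R)\gamma_4(F)}$ are functors from $\mathsf{Pres}(G)$ to abelian groups, and their limits $\varprojlim$ over $\mathsf{Pres}(G)$ are functors of $G$: for a homomorphism $h\colon G\to G'$, the induced map of limits is the one compatible with all maps induced by homomorphisms $F\to F'$ over $h$, for $F\twoheadrightarrow G$ in $\mathsf{Pres}(G)$ and $F'\twoheadrightarrow G'$ in $\mathsf{Pres}(G')$. **Theorem.** There is a short exact sequence of abelian groups, natural in the group $G$, $$ \varprojlim \frac{R\cap \gamma_2(F)}{\gamma_2(R)(R\cap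 \gamma_4(F))}\hookrightarrow \varprojlim \frac{\gamma_2(F)}{\gamma_2(R)\gamma_4(F)}\twoheadrightarrow \frac{D_4(G)}{\gamma_4(G)}. $$ Here the first map is induced by the inclusions $R\cap\gamma_2(F)\subseteq\gamma_2(F)$, and the second map is induced by the projections $\pi\colon F\to G$: if the component of $x$ at a presentation $\pi\colon F\twoheadrightarrow G$ is the class of $w\in\gamma_2(F)$, then $\pi(w)\in D_4(G)$ and $x$ is sent to the class of $\pi(w)$. -/

import Mathlib

open CategoryTheory CategoryTheory.Limits

universe u

namespace PresLim

/-! ### Lower central series and dimension subgroups -/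

/-- `γ n H` is the `n`-th term of the lower central series of the group `H`, for `n ≥ 1`, with
the convention `γ 1 H = H`, `γ (n + 1) H = [γ n H, H]` (Mathlib numbers the terms from `0`). -/
def γ (n : ℕ) (H : Type*) [Group H] : Subgroup H :=
  (⊤ : Subgroup H).lowerCentralSeries (n - 1)

instance γ_normal (n : ℕ) (H : Type*) [Group H] : (γ n H).Normal := by
  unfold γ; infer_instance

/-- The augmentation ideal of the integral group ring `ℤ[H]`. -/
noncomputable def augIdeal (H : Type*) [Group H] : Ideal (MonoidAlgebra ℤ H) :=
  RingHom.ker (MonoidAlgebra.lift ℤ ℤ H (1 : H →* ℤ))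

/-- The `n`-th dimension subgroup `D_n(H) = H ∩ (1 + 𝔥ⁿ)`, `𝔥` the augmentation ideal of `ℤ[H]`. -/
noncomputable def D (n : ℕ) (H : Type*) [Group H] : Subgroup H where
  carrier := {g | MonoidAlgebra.of ℤ H g - 1 ∈ augIdeal H ^ n}
  one_mem' := by
    change MonoidAlgebra.of ℤ H 1 - 1 ∈ augIdeal H ^ n
    rw [map_one, sub_self]; exact Ideal.zero_mem _
  mul_mem' {a b} ha hb := by
    have h : MonoidAlgebra.of ℤ H (a * b) - 1 = MonoidAlgebra.of ℤ H a *
        (MonoidAlgebra.of ℤ H b - 1) + (MonoidAlgebra.of ℤ H a - 1) := by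
      rw [map_mul]; noncomm_ring
    change MonoidAlgebra.of ℤ H (a * b) - 1 ∈ augIdeal H ^ n
    rw [h]
    exact Ideal.add_mem _ (Ideal.mul_mem_left _ _ hb) ha
  inv_mem' {a} ha := by
    have h : MonoidAlgebra.of ℤ H a⁻¹ - 1 = -(MonoidAlgebra.of ℤ H a⁻¹ *
        (MonoidAlgebra.of ℤ H a - 1)) := by
      rw [mul_sub, ← map_mul, inv_mul_cancel, map_one, mul_one, neg_sub]
    change MonoidAlgebra.of ℤ H a⁻¹ - 1 ∈ augIdeal H ^ n
    rw [h]
    exact (Ideal.neg_mem_iff _).2 (Ideal.mul_mem_left _ _ ha)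

theorem mem_D {n : ℕ} {H : Type*} [Group H] {g : H} :
    g ∈ D n H ↔ MonoidAlgebra.of ℤ H g - 1 ∈ augIdeal H ^ n := Iff.rfl

theorem map_γ_le (n : ℕ) {H K : Type*} [Group H] [Group K] (f : H →* K) :
    γ n H ≤ (γ n K).comap f := by
  rw [← Subgroup.map_le_iff_le_comap]
  unfold γ
  generalize n - 1 = m
  induction m with
  | zero => simp
  | succ m ih =>
    rw [Subgroup.lowerCentralSeries_succ, Subgroup.lowerCentralSeries_succ,
      Subgroup.map_commutator]
    exact Subgroup.commutator_mono ih le_top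

/-- `[γ₂(H), γ₂(H)] ⊆ γ₄(H)`. -/
theorem commutator_γ_two (H : Type*) [Group H] : ⁅γ 2 H, γ 2 H⁆ ≤ γ 4 H := by
  have e : ∀ K : Subgroup H, K ≤ γ 4 H ↔ K.map (QuotientGroup.mk' (γ 4 H)) = ⊥ := by
    intro K
    rw [Subgroup.map_eq_bot_iff, QuotientGroup.ker_mk']
  have h4 : ⁅⁅γ 2 H, (⊤ : Subgroup H)⁆, (⊤ : Subgroup H)⁆ ≤ γ 4 H := le_rfl
  have h4' : ⁅⁅(⊤ : Subgroup H), γ 2 H⁆, (⊤ : Subgroup H)⁆ ≤ γ 4 H := by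
    rw [Subgroup.commutator_comm ⊤ (γ 2 H)]; exact h4
  have h2 : γ 2 H = ⁅(⊤ : Subgroup H), (⊤ : Subgroup H)⁆ := rfl
  have : ⁅⁅(⊤ : Subgroup H), (⊤ : Subgroup H)⁆, γ 2 H⁆ ≤ γ 4 H := by
    rw [e] at h4 h4' ⊢
    simp only [Subgroup.map_commutator] at h4 h4' ⊢
    exact Subgroup.commutator_commutator_eq_bot_of_rotate h4' h4
  rwa [← h2] at this

theorem map_augIdeal_pow (n : ℕ) {H K : Type*} [Group H] [Group K] (f : H →* K)
    (x : MonoidAlgebra ℤ H) (hx : x ∈ augIdeal H ^ n) :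
    MonoidAlgebra.mapDomainRingHom ℤ f x ∈ augIdeal K ^ n := by
  have h1 : ∀ y : MonoidAlgebra ℤ H, y ∈ augIdeal H →
      MonoidAlgebra.mapDomainRingHom ℤ f y ∈ augIdeal K := by
    intro y hy
    have : ((MonoidAlgebra.lift ℤ ℤ K (1 : K →* ℤ) : MonoidAlgebra ℤ K →+* ℤ).comp
        (MonoidAlgebra.mapDomainRingHom ℤ f)) =
        (MonoidAlgebra.lift ℤ ℤ H (1 : H →* ℤ) : MonoidAlgebra ℤ H →+* ℤ) := by
      ext <;> simp
    have h := RingHom.congr_fun this y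
    simp only [augIdeal, RingHom.mem_ker] at hy ⊢
    exact h.trans hy
  induction n generalizing x with
  | zero =>
    rw [Submodule.pow_zero, Ideal.one_eq_top]; trivial
  | succ n ih =>
    rw [Submodule.pow_succ] at hx ⊢
    refine Submodule.smul_induction_on hx ?_ ?_
    · intro a ha b hb
      rw [smul_eq_mul, map_mul]
      exact Ideal.mul_mem_mul (ih a ha) (h1 b hb)
    · intro a b ha hb
      rw [map_add]
      exact Ideal.add_mem _ ha hb

theorem map_D_le (n : ℕ) {H K : Type*} [Group H] [Group K] (f : H →* K) :
    D n H ≤ (D n K).comap f := by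
  intro g hg
  have := map_augIdeal_pow n f _ (mem_D.1 hg)
  rw [Subgroup.mem_comap, mem_D]
  rw [map_sub, map_one] at this
  simpa [MonoidAlgebra.of_apply] using this

/-- `D₂(H) ⊆ γ₂(H)`. -/
theorem D_two_le (H : Type*) [Group H] : D 2 H ≤ γ 2 H := by
  let φ : MonoidAlgebra ℤ H →ₗ[ℤ] Additive (Abelianization H) :=
    (Finsupp.lift (Additive (Abelianization H)) ℤ H fun h => Additive.ofMul (Abelianization.of h)) ∘ₗ
      (MonoidAlgebra.coeffLinearEquiv ℤ).toLinearMap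
  have hφ : ∀ h : H, φ (MonoidAlgebra.of ℤ H h) = Additive.ofMul (Abelianization.of h) := by
    intro h
    simp [φ]
  let ε := MonoidAlgebra.lift ℤ ℤ H (1 : H →* ℤ)
  have hε : ∀ h : H, ε (MonoidAlgebra.of ℤ H h) = 1 := by
    intro h
    simp [ε]
  have key : ∀ a b : MonoidAlgebra ℤ H, φ (a * b) = ε a • φ b + ε b • φ a := by
    intro a b
    induction a using MonoidAlgebra.induction_on with
    | of g =>
      induction b using MonoidAlgebra.induction_on with
      | of h =>
        rw [← map_mul, hφ, hφ, hφ, hε, hε, map_mul, ofMul_mul, one_smul, one_smul, add_comm]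
      | add x y hx hy =>
        rw [mul_add, map_add, hx, hy, map_add, map_add, smul_add, add_smul]; abel
      | smul r x hx =>
        rw [mul_smul_comm, map_smul, hx, map_smul, map_smul, smul_add, smul_comm r, smul_assoc]
    | add x y hx hy =>
      rw [add_mul, map_add, hx, hy, map_add, map_add, smul_add, add_smul]; abel
    | smul r x hx =>
      rw [smul_mul_assoc, map_smul, hx, map_smul, map_smul, smul_add, smul_comm r (ε b), smul_assoc]
  have hz : ∀ x ∈ augIdeal H ^ 2, φ x = 0 := by
    intro x hx
    rw [Submodule.pow_succ, Submodule.pow_one] at hx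
    refine Submodule.smul_induction_on hx ?_ ?_
    · intro a ha b hb
      have ha' : ε a = 0 := ha
      have hb' : ε b = 0 := hb
      rw [smul_eq_mul, key, ha', hb', zero_smul, zero_smul, add_zero]
    · intro a b ha hb
      rw [map_add, ha, hb, add_zero]
  intro g hg
  have h := hz _ (mem_D.1 hg)
  rw [map_sub, ← map_one (MonoidAlgebra.of ℤ H), hφ, hφ, map_one, ofMul_one, sub_zero] at h
  have h' : Abelianization.of g = 1 := h
  have h'' : g ∈ (Abelianization.of (G := H)).ker := h'
  rw [Abelianization.ker_of] at h''
  exact h''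

theorem D_antitone (H : Type*) [Group H] : Antitone fun n => D n H :=
  fun _ _ h _ hg => Ideal.pow_le_pow_right h hg

/-! ### Abelian subquotients of a group -/

/-- For subgroups `A, N` of `E` with `N` normal and `[A, A] ⊆ N`, the group `A / (A ∩ N)` is
abelian (it is `A / N` when `N ⊆ A`). -/
@[reducible] def subquotCommGroup {E : Type u} [Group E] (A N : Subgroup E) [N.Normal]
    (h : ⁅A, A⁆ ≤ N) : CommGroup (A ⧸ N.subgroupOf A) :=
  { (inferInstance : Group (A ⧸ N.subgroupOf A)) with
    mul_comm := by
      intro a b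
      induction a using QuotientGroup.induction_on with | _ a
      induction b using QuotientGroup.induction_on with | _ b
      refine QuotientGroup.eq.2 ?_
      rw [Subgroup.mem_subgroupOf]
      have := h (Subgroup.commutator_mem_commutator (b⁻¹).2 (a⁻¹).2)
      simpa [commutatorElement_def, mul_assoc] using this }

/-- The abelian group `A / (A ∩ N)`, written additively, as an object of the category of
abelian groups. -/
abbrev subquot {E : Type u} [Group E] (A N : Subgroup E) [N.Normal] (h : ⁅A, A⁆ ≤ N) :
    AddCommGrpCat.{u} :=
  letI := subquotCommGroup A N h
  AddCommGrpCat.of (Additive (A ⧸ N.subgroupOf A))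

/-- The class of `a ∈ A` in the abelian group `A / (A ∩ N)`. -/
def subquotMk {E : Type u} [Group E] (A N : Subgroup E) [N.Normal] (h : ⁅A, A⁆ ≤ N) (a : A) :
    subquot A N h :=
  Additive.ofMul (QuotientGroup.mk a : A ⧸ N.subgroupOf A)

/-- The homomorphism `A / (A ∩ N) → A' / (A' ∩ N')`, `[a] ↦ [f a]`, induced by a homomorphism
`f : E → E'` with `f(A) ⊆ A'` and `f(N) ⊆ N'`. -/
def subquotMap {E E' : Type u} [Group E] [Group E'] {A N : Subgroup E} [N.Normal]
    {A' N' : Subgroup E'} [N'.Normal] (h : ⁅A, A⁆ ≤ N) (h' : ⁅A', A'⁆ ≤ N') (f : E →* E')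
    (hA : A ≤ A'.comap f) (hN : N ≤ N'.comap f) : subquot A N h ⟶ subquot A' N' h' :=
  letI := subquotCommGroup A N h
  letI := subquotCommGroup A' N' h'
  AddCommGrpCat.ofHom (MonoidHom.toAdditive
    (QuotientGroup.map (N.subgroupOf A) (N'.subgroupOf A')
      ((f.comp A.subtype).codRestrict A' fun a => hA a.2) fun _ ha => hN ha) :
        Additive (A ⧸ N.subgroupOf A) →+ Additive (A' ⧸ N'.subgroupOf A'))

theorem subquotMap_mk {E E' : Type u} [Group E] [Group E'] {A N : Subgroup E} [N.Normal]
    {A' N' : Subgroup E'} [N'.Normal] (h : ⁅A, A⁆ ≤ N) (h' : ⁅A', A'⁆ ≤ N') (f : E →* E')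
    (hA : A ≤ A'.comap f) (hN : N ≤ N'.comap f) (a : A) :
    subquotMap h h' f hA hN (subquotMk A N h a) = subquotMk A' N' h' ⟨f a, hA a.2⟩ :=
  rfl

theorem subquotMk_surjective {E : Type u} [Group E] (A N : Subgroup E) [N.Normal]
    (h : ⁅A, A⁆ ≤ N) : Function.Surjective (subquotMk A N h) :=
  fun x => QuotientGroup.mk_surjective (s := N.subgroupOf A) x

theorem subquot_hom_ext {E : Type u} [Group E] {A N : Subgroup E} [N.Normal] {h : ⁅A, A⁆ ≤ N}
    {X : AddCommGrpCat.{u}} {f g : subquot A N h ⟶ X}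
    (w : ∀ a, f (subquotMk A N h a) = g (subquotMk A N h a)) : f = g := by
  ext x
  obtain ⟨a, rfl⟩ := subquotMk_surjective A N h x
  exact w a

/-! ### The category of free presentations of a group -/

/-- A free presentation of `G`: a free group `F` with an epimorphism `π : F → G`. -/
structure Pres (G : Type u) [Group G] where
  F : Type u
  [group : Group F]
  [free : IsFreeGroup F]
  π : F →* G
  surj : Function.Surjective π

attribute [instance] Pres.group Pres.free

/-- The subgroup of relations `R = ker (F → G)`. -/
def Pres.R {G : Type u} [Group G] (c : Pres G) : Subgroup c.F := c.π.ker

instance Pres.R_normal {G : Type u} [Group G] (c : Pres G) : c.R.Normal := by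
  unfold Pres.R; infer_instance

/-- A morphism of free presentations of `G`: a homomorphism `F → F'` over `G`. -/
@[ext]
structure Pres.Hom {G : Type u} [Group G] (c c' : Pres G) where
  hom : c.F →* c'.F
  comm : c'.π.comp hom = c.π

/-- The category `Pres(G)`. -/
instance Pres.category {G : Type u} [Group G] : Category.{u} (Pres G) where
  Hom c c' := Pres.Hom c c'
  id c := ⟨MonoidHom.id _, rfl⟩
  comp f g := ⟨g.hom.comp f.hom, by rw [← MonoidHom.comp_assoc, g.comm, f.comm]⟩

/-- A free presentation `R ↪ F ↠ G` of some (varying) group `G`. -/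
structure AllPres : Type (u + 1) where
  G : GrpCat.{u}
  pres : Pres G

/-- A morphism from `F ↠ G` to `F' ↠ G'`: a commutative square of homomorphisms. -/
@[ext]
structure AllPres.Hom (c c' : AllPres.{u}) where
  base : c.G →* c'.G
  hom : c.pres.F →* c'.pres.F
  comm : c'.pres.π.comp hom = base.comp c.pres.π

/-- The category of free presentations of all groups. -/
instance AllPres.category : Category.{u} AllPres.{u} where
  Hom c c' := AllPres.Hom c c'
  id c := ⟨MonoidHom.id _, MonoidHom.id _, rfl⟩
  comp f g := ⟨g.base.comp f.base, g.hom.comp f.hom, by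
    rw [← MonoidHom.comp_assoc, g.comm, MonoidHom.comp_assoc, f.comm, MonoidHom.comp_assoc]⟩

/-- The (non-full) inclusion of `Pres(G)` in the category of all free presentations. -/
abbrev fiber (G : GrpCat.{u}) : Pres G ⥤ AllPres.{u} where
  obj c := ⟨G, c⟩
  map f := AllPres.Hom.mk (MonoidHom.id _) f.hom f.comm

/-! ### Limits over `Pres(G)`, and their functoriality in `G` -/

/-- The free presentation of `G` on the set `G × S`, with `(g, s) ↦ g`. -/
def stdPres (G : Type u) [Group G] (S : Type u) [Nonempty S] : Pres G where
  F := FreeGroup (G × S)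
  π := FreeGroup.lift Prod.fst
  surj g := ⟨FreeGroup.of (g, Classical.arbitrary S), by simp⟩

/-- A morphism from a standard presentation to an arbitrary one, over a given homomorphism,
prescribed on the generators. -/
def stdHom {G : GrpCat.{u}} (S : Type u) [Nonempty S] (c' : AllPres.{u}) (h : G →* c'.G)
    (t : G × S → c'.pres.F) (ht : ∀ x, c'.pres.π (t x) = h x.1) :
    (⟨G, stdPres G S⟩ : AllPres.{u}) ⟶ c' :=
  AllPres.Hom.mk h (FreeGroup.lift t) (by
    refine FreeGroup.ext_hom _ _ fun x => ?_
    change c'.pres.π (FreeGroup.lift t (FreeGroup.of x)) =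
      h (FreeGroup.lift Prod.fst (FreeGroup.of x))
    rw [FreeGroup.lift_apply_of, FreeGroup.lift_apply_of, ht])

/-- `stdPres G PUnit` maps to every free presentation, over any given homomorphism. -/
noncomputable def liftHom {G : GrpCat.{u}} (c' : AllPres.{u}) (h : G →* c'.G) :
    (⟨G, stdPres G PUnit.{u + 1}⟩ : AllPres.{u}) ⟶ c' :=
  stdHom _ c' h (fun x => (c'.pres.surj (h x.1)).choose) fun x => (c'.pres.surj (h x.1)).choose_spec

variable (𝓕 𝓖 : AllPres.{u} ⥤ AddCommGrpCat.{u})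

/-- `Pres(G)` is a large category, but limits of functors `Pres(G) → Ab` exist, since a
compatible family is determined by its value at one presentation that maps to all others. -/
instance hasLimit_fiber (G : GrpCat.{u}) : HasLimit (fiber G ⋙ 𝓕) := by
  let c₀ : Pres G := stdPres G PUnit.{u + 1}
  have hm : ∀ c : Pres G, Nonempty (c₀ ⟶ c) := fun c =>
    ⟨Pres.Hom.mk (liftHom ⟨G, c⟩ (MonoidHom.id _)).hom
      (liftHom ⟨G, c⟩ (MonoidHom.id _)).comm⟩
  have : Small.{u} ((fiber G ⋙ 𝓕) ⋙ forget AddCommGrpCat).sections := by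
    refine small_of_injective
      (f := fun s : ((fiber G ⋙ 𝓕) ⋙ forget AddCommGrpCat).sections => s.1 c₀) ?_
    intro s t hst
    apply Subtype.ext
    funext c
    obtain ⟨f⟩ := hm c
    rw [← s.2 f, ← t.2 f]
    exact congrArg _ hst
  infer_instance

/-- The projections of `lim 𝓕` equalize any two morphisms of presentations with the same base:
the composite only depends on the base. -/
theorem limit_π_std {G : GrpCat.{u}} {c' : AllPres.{u}}
    (φ ψ : (⟨G, stdPres G PUnit.{u + 1}⟩ : AllPres.{u}) ⟶ c') (h : φ.base = ψ.base) :
    limit.π (fiber G ⋙ 𝓕) (stdPres G PUnit.{u + 1}) ≫ 𝓕.map φ =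
      limit.π (fiber G ⋙ 𝓕) (stdPres G PUnit.{u + 1}) ≫ 𝓕.map ψ := by
  let d : Pres G := stdPres G (ULift.{u} Bool)
  let j (b : Bool) (x : G × PUnit.{u + 1}) : FreeGroup (G × ULift.{u} Bool) :=
    FreeGroup.of (x.1, ULift.up b)
  let i (b : Bool) : stdPres G PUnit.{u + 1} ⟶ d :=
    Pres.Hom.mk (FreeGroup.lift (j b))
      (FreeGroup.ext_hom _ _ fun x => by
        change FreeGroup.lift Prod.fst (FreeGroup.lift (j b) (FreeGroup.of x)) =
          FreeGroup.lift Prod.fst (FreeGroup.of x)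
        rw [FreeGroup.lift_apply_of, FreeGroup.lift_apply_of]
        exact Eq.symm (FreeGroup.lift_apply_of (f := (Prod.fst : G × PUnit.{u + 1} → G))))
  have hc : ∀ (χ : (⟨G, stdPres G PUnit.{u + 1}⟩ : AllPres.{u}) ⟶ c') (g : G),
      c'.pres.π (χ.hom (FreeGroup.of (g, PUnit.unit))) = χ.base g := by
    intro χ g
    refine (DFunLike.congr_fun χ.comm (FreeGroup.of (g, PUnit.unit))).trans ?_
    change χ.base (FreeGroup.lift Prod.fst (FreeGroup.of (g, PUnit.unit))) = _
    rw [FreeGroup.lift_apply_of]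
  let t : G × ULift.{u} Bool → c'.pres.F := fun x =>
    bif x.2.down then φ.hom (FreeGroup.of (x.1, PUnit.unit))
    else ψ.hom (FreeGroup.of (x.1, PUnit.unit))
  have ht : ∀ x, c'.pres.π (t x) = φ.base x.1 := by
    rintro ⟨g, ⟨_ | _⟩⟩
    · exact (hc ψ g).trans (by rw [h])
    · exact hc φ g
  let θ := stdHom (G := G) (ULift.{u} Bool) c' φ.base t ht
  have e1 : φ = (fiber G).map (i true) ≫ θ := by
    refine AllPres.Hom.ext rfl (FreeGroup.ext_hom _ _ fun x => ?_)
    change φ.hom (FreeGroup.of x) = FreeGroup.lift t (FreeGroup.lift (j true) (FreeGroup.of x))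
    rw [FreeGroup.lift_apply_of]
    exact Eq.symm (FreeGroup.lift_apply_of (f := t) (x := (x.1, ULift.up true)))
  have e2 : ψ = (fiber G).map (i false) ≫ θ := by
    refine AllPres.Hom.ext h.symm (FreeGroup.ext_hom _ _ fun x => ?_)
    change ψ.hom (FreeGroup.of x) = FreeGroup.lift t (FreeGroup.lift (j false) (FreeGroup.of x))
    rw [FreeGroup.lift_apply_of]
    exact Eq.symm (FreeGroup.lift_apply_of (f := t) (x := (x.1, ULift.up false)))
  have w : ∀ b, limit.π (fiber G ⋙ 𝓕) (stdPres G PUnit.{u + 1}) ≫ 𝓕.map ((fiber G).map (i b)) =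
      limit.π (fiber G ⋙ 𝓕) d := fun b => limit.w (fiber G ⋙ 𝓕) (i b)
  rw [e1, e2, 𝓕.map_comp, 𝓕.map_comp, ← Category.assoc, ← Category.assoc, w, w]

/-- The homomorphism `lim_{Pres(G)} 𝓕 → lim_{Pres(G')} 𝓕` induced by `h : G → G'`: its component
at a presentation `c'` of `G'` comes from any morphism over `h` from a presentation of `G`
to `c'`. -/
noncomputable def limPresHom {G G' : GrpCat.{u}} (h : G ⟶ G') :
    limit (fiber G ⋙ 𝓕) ⟶ limit (fiber G' ⋙ 𝓕) :=
  limit.lift (fiber G' ⋙ 𝓕)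
    { pt := limit (fiber G ⋙ 𝓕)
      π :=
        { app := fun c' => limit.π (fiber G ⋙ 𝓕) (stdPres G PUnit.{u + 1}) ≫
            𝓕.map (liftHom ⟨G', c'⟩ h.hom)
          naturality := by
            intro c' c'' f
            change 𝟙 _ ≫ _ = (_ ≫ _) ≫ 𝓕.map ((fiber G').map f)
            rw [Category.id_comp, Category.assoc, ← 𝓕.map_comp]
            exact limit_π_std 𝓕 _ _ rfl } }

/-- The characterization of `limPresHom`: it is compatible with all morphisms of presentations
over `h`. -/
theorem limPresHom_π {G G' : GrpCat.{u}} (h : G ⟶ G') (c : Pres G) (c' : Pres G')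
    (φ : (⟨G, c⟩ : AllPres.{u}) ⟶ ⟨G', c'⟩) (hφ : φ.base = h.hom) :
    limPresHom 𝓕 h ≫ limit.π (fiber G' ⋙ 𝓕) c' = limit.π (fiber G ⋙ 𝓕) c ≫ 𝓕.map φ := by
  let r : stdPres G PUnit.{u + 1} ⟶ c :=
    Pres.Hom.mk (liftHom ⟨G, c⟩ (MonoidHom.id _)).hom (liftHom ⟨G, c⟩ (MonoidHom.id _)).comm
  have w : limit.π (fiber G ⋙ 𝓕) (stdPres G PUnit.{u + 1}) ≫ 𝓕.map ((fiber G).map r) =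
      limit.π (fiber G ⋙ 𝓕) c := limit.w (fiber G ⋙ 𝓕) r
  rw [limPresHom, limit.lift_π, ← w, Category.assoc, ← 𝓕.map_comp]
  exact limit_π_std 𝓕 _ _ hφ.symm

/-- The functor `G ↦ lim_{Pres(G)} 𝓕` from groups to abelian groups. -/
noncomputable def limPres : GrpCat.{u} ⥤ AddCommGrpCat.{u} where
  obj G := limit (fiber G ⋙ 𝓕)
  map h := limPresHom 𝓕 h
  map_id G := by
    refine limit.hom_ext fun c => ?_
    rw [limPresHom_π 𝓕 (𝟙 G) c c (𝟙 _) rfl, 𝓕.map_id, Category.id_comp]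
    exact Category.comp_id _
  map_comp {G G' G''} h k := by
    refine limit.hom_ext fun c'' => ?_
    let b : Pres G' := stdPres G' PUnit.{u + 1}
    let a : Pres G := stdPres G PUnit.{u + 1}
    let φ : (⟨G, a⟩ : AllPres.{u}) ⟶ ⟨G', b⟩ := liftHom ⟨G', b⟩ h.hom
    let ψ : (⟨G', b⟩ : AllPres.{u}) ⟶ ⟨G'', c''⟩ := liftHom ⟨G'', c''⟩ k.hom
    rw [Category.assoc, limPresHom_π 𝓕 k b c'' ψ rfl, ← Category.assoc, limPresHom_π 𝓕 h a b φ rfl,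
      Category.assoc, ← 𝓕.map_comp]
    exact limPresHom_π 𝓕 (h ≫ k) a c'' (φ ≫ ψ) rfl

variable {𝓕 𝓖}

/-- The homomorphisms `lim_{Pres(G)} 𝓕 → lim_{Pres(G)} 𝓖` induced by a natural
transformation `𝓕 → 𝓖`. -/
noncomputable def limPresMap (α : 𝓕 ⟶ 𝓖) : limPres 𝓕 ⟶ limPres 𝓖 where
  app G := Limits.limMap (Functor.whiskerLeft (fiber G) α)
  naturality {G G'} h := by
    refine limit.hom_ext fun c' => ?_
    let a : Pres G := stdPres G PUnit.{u + 1}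
    let φ : (fiber G).obj a ⟶ (fiber G').obj c' := liftHom ⟨G', c'⟩ h.hom
    change (limPresHom 𝓕 h ≫ Limits.limMap (Functor.whiskerLeft (fiber G') α)) ≫ _ =
      (Limits.limMap (Functor.whiskerLeft (fiber G) α) ≫ limPresHom 𝓖 h) ≫ _
    rw [Category.assoc, Category.assoc, limPresHom_π 𝓖 h a c' φ rfl, Limits.limMap_π, Limits.limMap_π_assoc,
      reassoc_of% limPresHom_π 𝓕 h a c' φ rfl]
    congr 1
    exact α.naturality φ

/-! ### The functors of the exact sequence -/

/-- For a morphism of presentations, `R` is mapped into `R'`. -/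
theorem AllPres.map_R_le {c c' : AllPres.{u}} (f : AllPres.Hom c c') :
    c.pres.R ≤ c'.pres.R.comap f.hom := by
  intro x hx
  have h : c.pres.π x = 1 := hx
  change c'.pres.π (f.hom x) = 1
  rw [← MonoidHom.comp_apply, f.comm, MonoidHom.comp_apply, h, map_one]

theorem AllPres.map_γ₂R_le {c c' : AllPres.{u}} (f : AllPres.Hom c c') :
    ⁅c.pres.R, c.pres.R⁆ ≤ (⁅c'.pres.R, c'.pres.R⁆ : Subgroup c'.pres.F).comap f.hom := by
  rw [← Subgroup.map_le_iff_le_comap, Subgroup.map_commutator]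
  exact Subgroup.commutator_mono (Subgroup.map_le_iff_le_comap.2 (map_R_le f))
    (Subgroup.map_le_iff_le_comap.2 (map_R_le f))

/-- `γ₂(R)(R ∩ γ₄(F))`; here `γ₂(R) = [R, R]` as a subgroup of `F`, and the product of normal
subgroups is their join. -/
abbrev relDenom {G : Type u} [Group G] (c : Pres G) : Subgroup c.F :=
  ⁅c.R, c.R⁆ ⊔ (c.R ⊓ γ 4 c.F)

/-- `γ₂(R)γ₄(F)`. -/
abbrev allDenom {G : Type u} [Group G] (c : Pres G) : Subgroup c.F :=
  ⁅c.R, c.R⁆ ⊔ γ 4 c.F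

theorem relDenom_comm {G : Type u} [Group G] (c : Pres G) :
    ⁅c.R ⊓ γ 2 c.F, c.R ⊓ γ 2 c.F⁆ ≤ relDenom c :=
  (Subgroup.commutator_mono inf_le_left inf_le_left).trans le_sup_left

theorem allDenom_comm {G : Type u} [Group G] (c : Pres G) :
    ⁅γ 2 c.F, γ 2 c.F⁆ ≤ allDenom c :=
  (commutator_γ_two c.F).trans le_sup_right

theorem map_relDenom_le {c c' : AllPres.{u}} (f : AllPres.Hom c c') :
    relDenom c.pres ≤ (relDenom c'.pres).comap f.hom :=
  sup_le (fun _ hx => (le_sup_left : _ ≤ relDenom c'.pres) (AllPres.map_γ₂R_le f hx))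
    fun _ hx => (le_sup_right : _ ≤ relDenom c'.pres)
      ⟨AllPres.map_R_le f hx.1, map_γ_le 4 f.hom hx.2⟩

theorem map_allDenom_le {c c' : AllPres.{u}} (f : AllPres.Hom c c') :
    allDenom c.pres ≤ (allDenom c'.pres).comap f.hom :=
  sup_le (fun _ hx => (le_sup_left : _ ≤ allDenom c'.pres) (AllPres.map_γ₂R_le f hx))
    fun _ hx => (le_sup_right : _ ≤ allDenom c'.pres) (map_γ_le 4 f.hom hx)

/-- The functor `(F, R) ↦ (R ∩ γ₂(F)) / (γ₂(R)(R ∩ γ₄(F)))`. -/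
def relQuot : AllPres.{u} ⥤ AddCommGrpCat.{u} where
  obj c := subquot (c.pres.R ⊓ γ 2 c.pres.F) (relDenom c.pres) (relDenom_comm c.pres)
  map f := subquotMap _ _ f.hom
    (inf_le_inf (AllPres.map_R_le f) (map_γ_le 2 f.hom))
    (map_relDenom_le f)
  map_id _ := subquot_hom_ext fun _ => rfl
  map_comp _ _ := subquot_hom_ext fun _ => rfl

/-- The functor `(F, R) ↦ γ₂(F) / (γ₂(R)γ₄(F))`. -/
def allQuot : AllPres.{u} ⥤ AddCommGrpCat.{u} where
  obj c := subquot (γ 2 c.pres.F) (allDenom c.pres) (allDenom_comm c.pres)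
  map f := subquotMap _ _ f.hom (map_γ_le 2 f.hom)
    (map_allDenom_le f)
  map_id _ := subquot_hom_ext fun _ => rfl
  map_comp _ _ := subquot_hom_ext fun _ => rfl

/-- The natural transformation induced by the inclusions `R ∩ γ₂(F) ⊆ γ₂(F)`. -/
def inclQuot : relQuot.{u} ⟶ allQuot.{u} where
  app c := subquotMap (relDenom_comm c.pres) (allDenom_comm c.pres) (MonoidHom.id _) inf_le_right
    (sup_le_sup_left inf_le_right _)
  naturality _ _ _ := subquot_hom_ext fun _ => rfl

theorem D_four_comm (G : Type u) [Group G] : ⁅D 4 G, D 4 G⁆ ≤ γ 4 G :=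
  have h : D 4 G ≤ γ 2 G := (D_antitone G (show 2 ≤ 4 by norm_num)).trans (D_two_le G)
  (Subgroup.commutator_mono h h).trans (commutator_γ_two G)

/-- The fourth dimension quotient `G ↦ D₄(G) / γ₄(G)`, as a functor from groups to abelian
groups. -/
noncomputable def dimQuot : GrpCat.{u} ⥤ AddCommGrpCat.{u} where
  obj G := subquot (D 4 G) (γ 4 G) (D_four_comm G)
  map f := subquotMap _ _ f.hom (map_D_le 4 f.hom) (map_γ_le 4 f.hom)
  map_id _ := subquot_hom_ext fun _ => rfl
  map_comp _ _ := subquot_hom_ext fun _ => rfl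

/-- The class in `γ₂(F) / (γ₂(R)γ₄(F))` of `w ∈ γ₂(F)`. -/
def allClass {G : GrpCat.{u}} (c : Pres G) (w : γ 2 c.F) : (fiber G ⋙ allQuot).obj c :=
  subquotMk (γ 2 c.F) (allDenom c) (allDenom_comm c) w

/-- The class in `D₄(G) / γ₄(G)` of `g ∈ D₄(G)`. -/
noncomputable def dimClass (G : GrpCat.{u}) (g : D 4 G) : dimQuot.obj G :=
  subquotMk (D 4 G) (γ 4 G) (D_four_comm G) g

end PresLim

open PresLim

/-!
Since the standard presentation maps to every other one, `lim 𝓕` over `Pres(G)` consists of the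
elements of `𝓕` at the standard presentation which have the same image under any two morphisms to
another presentation. Everything is compared inside `γ₂(G) / γ₄(G)`: the kernel of
`γ₂(F) / (γ₂(R)γ₄(F)) → γ₂(G) / γ₄(G)` is the relation quotient, so by left exactness of limits it
remains to see that the image of the limit in `γ₂(G) / γ₄(G)` is `D₄(G) / γ₄(G)`.

* An element `g` of `D₄(G)` lifts to some `w ∈ F ∩ (1 + 𝔯𝔣 + 𝔣⁴)`. If `φ, ψ : F → F'` are
  morphisms over `G`, then `a ↦ φ(a)ψ(a)⁻¹` is a crossed homomorphism to the image of `R'` in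
  `F' / (γ₂(R')γ₄(F'))`, which is an abelian group. Such crossed homomorphisms vanish on
  `F ∩ (1 + 𝔯𝔣 + 𝔣⁴)`, so the class of `w` belongs to the limit.
* Conversely, let the class of `w` belong to the limit, and apply the two inclusions of `F` in its
  double `F * F → G`: they agree on `w` modulo `γ₂(R')γ₄(F * F) ⊆ 1 + 𝔯'𝔣' + 𝔣'⁴`, where `R'` is
  the kernel of the double. The crossed homomorphism `F * F → ℤ[G]` which is `0` on the first copy
  and `x ↦ π(x) - 1` on the second maps `F * F ∩ (1 + 𝔯'𝔣' + 𝔣'⁴)` into the fourth power of the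
  augmentation ideal, so `π(w) - 1` lies in that power.
-/

namespace PresLim

section GroupRing

open MonoidAlgebra (of mapDomainRingHom)

variable {F G H : Type*} [Group F] [Group G] [Group H]

instance augIdeal_isTwoSided : (augIdeal H).IsTwoSided := by
  unfold augIdeal; infer_instance

theorem of_sub_one_mem_augIdeal (h : H) : of ℤ H h - 1 ∈ augIdeal H := by
  simp [augIdeal, RingHom.mem_ker]

theorem map_mem_of_forall_of {A : Type*} [AddCommGroup A] (f : MonoidAlgebra ℤ H →+ A)
    (S : AddSubgroup A) (hf : ∀ h, f (of ℤ H h) ∈ S) (x : MonoidAlgebra ℤ H) : f x ∈ S := by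
  induction x using MonoidAlgebra.induction_on with
  | of h => exact hf h
  | add x y hx hy => simpa only [map_add] using add_mem hx hy
  | smul n x hx => simpa only [map_zsmul] using zsmul_mem hx n

theorem augIdeal_le_closure_of_sub_one :
    (augIdeal H).toAddSubgroup ≤ AddSubgroup.closure (Set.range fun h : H => of ℤ H h - 1) := by
  intro x (hx : MonoidAlgebra.lift ℤ ℤ H 1 x = 0)
  let ε : MonoidAlgebra ℤ H →+ ℤ := (MonoidAlgebra.lift ℤ ℤ H (1 : H →* ℤ)).toAddMonoidHom
  let proj : MonoidAlgebra ℤ H →+ MonoidAlgebra ℤ H :=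
    AddMonoidHom.id _ - (Int.castAddHom _).comp ε
  have hproj : proj x = x := by
    simp [proj, ε, hx]
  rw [← hproj]
  refine map_mem_of_forall_of proj _ (fun h => ?_) x
  have hproj_of : proj (of ℤ H h) = of ℤ H h - 1 := by simp [proj, ε]
  exact hproj_of ▸ AddSubgroup.subset_closure ⟨h, rfl⟩

@[simp]
theorem mapDomainRingHom_of (π : F →* G) (a : F) :
    mapDomainRingHom ℤ π (of ℤ F a) = of ℤ G (π a) := by
  simp

theorem mapDomainRingHom_surjective {π : F →* G} (hπ : Function.Surjective π) :
    Function.Surjective (mapDomainRingHom ℤ π) := fun y =>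
  map_mem_of_forall_of (AddMonoidHom.id _) (mapDomainRingHom ℤ π).range.toAddSubgroup
    (fun g => (hπ g).imp' (of ℤ F) fun a ha => by rw [mapDomainRingHom_of, ha]; rfl) y

theorem comap_augIdeal (π : F →* G) :
    (augIdeal G).comap (mapDomainRingHom ℤ π) = augIdeal F := by
  have h : (MonoidAlgebra.lift ℤ ℤ G (1 : G →* ℤ) : MonoidAlgebra ℤ G →+* ℤ).comp
      (mapDomainRingHom ℤ π) = (MonoidAlgebra.lift ℤ ℤ F (1 : F →* ℤ)) := by
    ext <;> simp
  exact Ideal.ext fun x => by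
    exact (congrArg (· = 0) (RingHom.congr_fun h x)).to_iff

end GroupRing

section CrossedHom

open MonoidAlgebra (of)

variable {E S A : Type*} [Group E] [Ring S] [AddCommGroup A] [Module S A]
  {T : MonoidAlgebra ℤ E →+* S} {δ δ' : E → A}

/-- `δ` is a crossed homomorphism (derivation) from `E` to the `S`-module `A`, on which `E` acts
through the ring homomorphism `T : ℤ[E] → S`. -/
def IsCrossedHom (T : MonoidAlgebra ℤ E →+* S) (δ : E → A) : Prop :=
  ∀ a b, δ (a * b) = δ a + T (of ℤ E a) • δ b

theorem isCrossedHom_of_sub_one (T : MonoidAlgebra ℤ E →+* S) :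
    IsCrossedHom T fun a => T (of ℤ E a) - 1 := fun a b => by
  simp only [map_mul, smul_eq_mul]; noncomm_ring

namespace IsCrossedHom

theorem map_one (hδ : IsCrossedHom T δ) : δ 1 = 0 := by
  have h := hδ 1 1
  rwa [mul_one, (of ℤ E).map_one, T.map_one, one_smul, left_eq_add] at h

theorem sub (hδ : IsCrossedHom T δ) (hδ' : IsCrossedHom T δ') :
    IsCrossedHom T fun a => δ a - δ' a := fun a b => by
  simp only [hδ a b, hδ' a b, smul_sub]; abel

theorem comp (hδ : IsCrossedHom T δ) {E' : Type*} [Group E'] (f : E' →* E) :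
    IsCrossedHom (T.comp (MonoidAlgebra.mapDomainRingHom ℤ f)) (δ ∘ f) := fun a b => by
  simp only [Function.comp_apply, map_mul, hδ (f a), RingHom.comp_apply, mapDomainRingHom_of]

/-- The subgroup of the elements at which a crossed homomorphism takes values in the submodule
`N`. -/
def comap (hδ : IsCrossedHom T δ) (N : Submodule S A) : Subgroup E where
  carrier := {a | δ a ∈ N}
  one_mem' := by
    rw [Set.mem_ofPred_eq, hδ.map_one]
    exact N.zero_mem
  mul_mem' {a b} ha hb := by
    rw [Set.mem_ofPred_eq, hδ]
    exact N.add_mem ha (N.smul_mem _ hb)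
  inv_mem' {a} ha := by
    have h : δ a⁻¹ + T (of ℤ E a⁻¹) • δ a = 0 := by rw [← hδ, inv_mul_cancel, hδ.map_one]
    rw [Set.mem_ofPred_eq, eq_neg_of_add_eq_zero_left h]
    exact N.neg_mem (N.smul_mem _ ha)

theorem sub_eq_smul_inv_mul (hδ : IsCrossedHom T δ) (a b : E) :
    δ b - δ a = T (of ℤ E a) • δ (a⁻¹ * b) := by
  rw [sub_eq_iff_eq_add', ← hδ, mul_inv_cancel_left]

end IsCrossedHom

/-- The additive extension of a map from `E` to the integral group ring of `E`. -/
noncomputable def linExt (δ : E → A) : MonoidAlgebra ℤ E →+ A :=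
  ((Finsupp.lift A ℤ E δ) ∘ₗ (MonoidAlgebra.coeffLinearEquiv ℤ).toLinearMap).toAddMonoidHom

@[simp]
theorem linExt_of (δ : E → A) (a : E) : linExt δ (of ℤ E a) = δ a := by
  simp [linExt]

namespace IsCrossedHom

theorem linExt_of_sub_one (hδ : IsCrossedHom T δ) (b : E) : linExt δ (of ℤ E b - 1) = δ b := by
  rw [map_sub, ← (of ℤ E).map_one, linExt_of, linExt_of, hδ.map_one, sub_zero]

theorem linExt_mul_of_sub_one (hδ : IsCrossedHom T δ) (x : MonoidAlgebra ℤ E) (b : E) :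
    linExt δ (x * (of ℤ E b - 1)) = T x • δ b := by
  let f : MonoidAlgebra ℤ E →+ A := (linExt δ).comp (AddMonoidHom.mulRight (of ℤ E b - 1)) -
    ((AddMonoidHom.flip (AddMonoidHom.smul (M := A) (R := S))) (δ b)).comp T.toAddMonoidHom
  refine sub_eq_zero.1 ((AddSubgroup.mem_bot).1 (map_mem_of_forall_of f ⊥ (fun a => ?_) x))
  have h : linExt δ (of ℤ E a * (of ℤ E b - 1)) = T (of ℤ E a) • δ b := by
    rw [mul_sub, mul_one, map_sub, ← map_mul, linExt_of, linExt_of, hδ, add_sub_cancel_left]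
  exact sub_eq_zero.2 h

theorem apply_mem_of_sub_one_mem_mul (hδ : IsCrossedHom T δ) {J : Ideal (MonoidAlgebra ℤ E)}
    {N : AddSubgroup A} (hJ : ∀ x ∈ J, ∀ b, T x • δ b ∈ N) {w : E}
    (hw : of ℤ E w - 1 ∈ J * augIdeal E) : δ w ∈ N := by
  suffices h : ∀ z ∈ J * augIdeal E, linExt δ z ∈ N from hδ.linExt_of_sub_one w ▸ h _ hw
  intro z hz
  refine Submodule.smul_induction_on hz (fun x hx y hy => ?_) fun y z hy hz => by
    simpa only [map_add] using add_mem hy hz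
  refine AddSubgroup.closure_induction (p := fun y _ => linExt δ (x • y) ∈ N) ?_ ?_ ?_ ?_
    (augIdeal_le_closure_of_sub_one hy)
  · rintro _ ⟨b, rfl⟩
    exact hδ.linExt_mul_of_sub_one x b ▸ hJ x hx b
  · simp
  · intro y z _ _ hy hz
    simpa only [smul_add, map_add] using add_mem hy hz
  · intro y _ hy
    simpa only [smul_neg, map_neg] using neg_mem hy

end IsCrossedHom

variable {X : Type*}

theorem exists_isCrossedHom_freeGroup (T : MonoidAlgebra ℤ (FreeGroup X) →+* S) (v : X → A) :
    ∃ δ : FreeGroup X → A, IsCrossedHom T δ ∧ ∀ x, δ (FreeGroup.of x) = v x := by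
  let act : FreeGroup X →* MulAut (Multiplicative A) :=
    ((MulAutMultiplicative A).symm.toMonoidHom.comp (DistribMulAction.toAddAut Sˣ A)).comp
      (MonoidHom.toHomUnits ((T : _ →* S).comp (of ℤ (FreeGroup X))))
  let s : FreeGroup X →* Multiplicative A ⋊[act] FreeGroup X :=
    FreeGroup.lift fun x => ⟨Multiplicative.ofAdd (v x), FreeGroup.of x⟩
  have hs : SemidirectProduct.rightHom.comp s = MonoidHom.id _ :=
    FreeGroup.ext_hom _ _ fun x => by simp [s]
  refine ⟨fun a => (s a).left.toAdd, fun a b => ?_, fun x => by simp [s]⟩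
  have ha : (s a).right = a := DFunLike.congr_fun hs a
  simp only [map_mul, SemidirectProduct.mul_left, ha, toAdd_mul]
  rfl

theorem IsCrossedHom.eq_of_freeGroup {T : MonoidAlgebra ℤ (FreeGroup X) →+* S}
    {δ δ' : FreeGroup X → A} (hδ : IsCrossedHom T δ) (hδ' : IsCrossedHom T δ')
    (h : ∀ x, δ (FreeGroup.of x) = δ' (FreeGroup.of x)) : δ = δ' := by
  have htop : ⊤ ≤ (hδ.sub hδ').comap ⊥ := by
    rw [← FreeGroup.closure_range_of, Subgroup.closure_le]
    rintro _ ⟨x, rfl⟩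
    exact sub_eq_zero.2 (h x)
  exact funext fun a => sub_eq_zero.1 (htop (Subgroup.mem_top a))

end CrossedHom

section CongrSubgroup

open MonoidAlgebra (of mapDomainRingHom)
open scoped commutatorElement

variable {F G : Type*} [Group F] [Group G]

/-- The subgroup `F ∩ (1 + I)` attached to a left ideal `I` of `ℤ[F]`. -/
noncomputable def congrSubgroup (I : Ideal (MonoidAlgebra ℤ F)) : Subgroup F :=
  (isCrossedHom_of_sub_one (RingHom.id _)).comap I

theorem mem_congrSubgroup {I : Ideal (MonoidAlgebra ℤ F)} {a : F} :
    a ∈ congrSubgroup I ↔ of ℤ F a - 1 ∈ I := Iff.rfl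

theorem inv_mul_mem_congrSubgroup_iff {I : Ideal (MonoidAlgebra ℤ F)} {a b : F} :
    a⁻¹ * b ∈ congrSubgroup I ↔ of ℤ F b - of ℤ F a ∈ I := by
  have h : of ℤ F b - of ℤ F a = of ℤ F a * (of ℤ F (a⁻¹ * b) - 1) := by
    rw [mul_sub, mul_one, ← map_mul, mul_inv_cancel_left]
  have h' : of ℤ F (a⁻¹ * b) - 1 = of ℤ F a⁻¹ * (of ℤ F b - of ℤ F a) := by
    rw [mul_sub, ← map_mul, ← map_mul, inv_mul_cancel, map_one]
  rw [mem_congrSubgroup]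
  exact ⟨fun ha => h ▸ I.mul_mem_left _ ha, fun ha => h' ▸ I.mul_mem_left _ ha⟩

theorem commutatorElement_mem_congrSubgroup {I : Ideal (MonoidAlgebra ℤ F)} [I.IsTwoSided]
    {a b : F} (hab : (of ℤ F a - 1) * (of ℤ F b - 1) ∈ I)
    (hba : (of ℤ F b - 1) * (of ℤ F a - 1) ∈ I) : ⁅a, b⁆ ∈ congrSubgroup I := by
  have h : of ℤ F ⁅a, b⁆ - 1 = ((of ℤ F a - 1) * (of ℤ F b - 1) -
      (of ℤ F b - 1) * (of ℤ F a - 1)) * of ℤ F (a⁻¹ * b⁻¹) := by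
    have h₁ : of ℤ F ⁅a, b⁆ = of ℤ F a * of ℤ F b * of ℤ F (a⁻¹ * b⁻¹) := by
      rw [← map_mul, ← map_mul, commutatorElement_def, mul_assoc (a * b)]
    have h₂ : of ℤ F b * of ℤ F a * of ℤ F (a⁻¹ * b⁻¹) = 1 := by
      rw [← map_mul, ← map_mul, ← mul_inv_rev, mul_inv_cancel, map_one]
    calc of ℤ F ⁅a, b⁆ - 1
        = (of ℤ F a * of ℤ F b - of ℤ F b * of ℤ F a) * of ℤ F (a⁻¹ * b⁻¹) := by
          rw [sub_mul, h₁, h₂]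
      _ = _ := by noncomm_ring
  rw [mem_congrSubgroup, h]
  exact I.mul_mem_right _ (I.sub_mem hab hba)

theorem γ_le_D (n : ℕ) : γ n F ≤ D n F := by
  rcases n with _ | n
  · exact fun a _ => mem_D.2 (by rw [Submodule.pow_zero, Ideal.one_eq_top]; trivial)
  · induction n with
    | zero => exact fun a _ => mem_D.2 (by
        rw [zero_add, Submodule.pow_one]; exact of_sub_one_mem_augIdeal a)
    | succ n ih =>
      refine Subgroup.commutator_le.2 fun a ha b _ => commutatorElement_mem_congrSubgroup ?_ ?_
      · rw [Submodule.pow_succ]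
        exact Ideal.mul_mem_mul (mem_D.1 (ih ha)) (of_sub_one_mem_augIdeal b)
      · rw [Ideal.IsTwoSided.pow_succ (I := augIdeal F)]
        exact Ideal.mul_mem_mul (of_sub_one_mem_augIdeal b) (mem_D.1 (ih ha))

/-- For an epimorphism `π : F → G` with kernel `R` this is the ideal `𝔯𝔣 + 𝔣ⁿ⁺¹` of `ℤ[F]`, where
`𝔣` is the augmentation ideal and `𝔯 = (R - 1)ℤ[F]`: the ideal `𝔯 + 𝔣ⁿ` is the preimage of the
`n`-th power of the augmentation ideal of `ℤ[G]`. -/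
noncomputable def relAugIdeal (π : F →* G) (n : ℕ) : Ideal (MonoidAlgebra ℤ F) :=
  (augIdeal G ^ n).comap (mapDomainRingHom ℤ π) * augIdeal F

instance relAugIdeal_isTwoSided (π : F →* G) (n : ℕ) : (relAugIdeal π n).IsTwoSided := by
  unfold relAugIdeal; infer_instance

theorem of_sub_one_mem_comap_of_mem_ker {π : F →* G} {r : F} (hr : r ∈ π.ker)
    (J : Ideal (MonoidAlgebra ℤ G)) : of ℤ F r - 1 ∈ J.comap (mapDomainRingHom ℤ π) := by
  rw [Ideal.mem_comap, map_sub, mapDomainRingHom_of, MonoidHom.mem_ker.1 hr, map_one, map_one,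
    sub_self]
  exact J.zero_mem

theorem of_sub_one_mul_mem_relAugIdeal {π : F →* G} (n : ℕ) {r : F} (hr : r ∈ π.ker) (a : F) :
    (of ℤ F r - 1) * (of ℤ F a - 1) ∈ relAugIdeal π n :=
  Ideal.mul_mem_mul (of_sub_one_mem_comap_of_mem_ker hr _) (of_sub_one_mem_augIdeal a)

theorem augIdeal_pow_succ_le_relAugIdeal (π : F →* G) (n : ℕ) :
    augIdeal F ^ (n + 1) ≤ relAugIdeal π n := by
  rw [Submodule.pow_succ]
  exact Ideal.mul_mono_left fun x hx => map_augIdeal_pow n π x hx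

theorem relAugIdeal_le_augIdeal_sq (π : F →* G) {n : ℕ} (hn : n ≠ 0) :
    relAugIdeal π n ≤ augIdeal F ^ 2 := by
  rw [Submodule.pow_succ, Submodule.pow_one]
  refine Ideal.mul_mono_left ?_
  rw [← comap_augIdeal π]
  exact Ideal.comap_mono (Ideal.pow_le_self hn)

theorem commutator_ker_sup_γ_le_congrSubgroup (π : F →* G) (n : ℕ) :
    ⁅π.ker, π.ker⁆ ⊔ γ (n + 1) F ≤ congrSubgroup (relAugIdeal π n) :=
  sup_le
    (Subgroup.commutator_le.2 fun r hr s hs => commutatorElement_mem_congrSubgroup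
      (of_sub_one_mul_mem_relAugIdeal n hr s) (of_sub_one_mul_mem_relAugIdeal n hs r))
    fun _ hw => augIdeal_pow_succ_le_relAugIdeal π n (γ_le_D _ hw)

theorem congrSubgroup_relAugIdeal_le_γ_two (π : F →* G) {n : ℕ} (hn : n ≠ 0) :
    congrSubgroup (relAugIdeal π n) ≤ γ 2 F := fun _ hw =>
  D_two_le F (relAugIdeal_le_augIdeal_sq π hn hw)

theorem exists_mem_relAugIdeal {π : F →* G} (hπ : Function.Surjective π) {n : ℕ}
    {y : MonoidAlgebra ℤ G} (hy : y ∈ augIdeal G ^ (n + 1)) :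
    ∃ x ∈ relAugIdeal π n, mapDomainRingHom ℤ π x = y := by
  rw [Submodule.pow_succ] at hy
  refine Submodule.smul_induction_on hy (fun y hy z hz => ?_) fun y z hy hz => ?_
  · obtain ⟨x, rfl⟩ := mapDomainRingHom_surjective hπ y
    obtain ⟨t, rfl⟩ := mapDomainRingHom_surjective hπ z
    exact ⟨x * t, Ideal.mul_mem_mul hy (comap_augIdeal π ▸ hz), map_mul _ _ _⟩
  · obtain ⟨x, hx, rfl⟩ := hy
    obtain ⟨t, ht, rfl⟩ := hz
    exact ⟨x + t, add_mem hx ht, map_add _ _ _⟩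

theorem exists_mem_ker_sub_mem_relAugIdeal {π : F →* G} (hπ : Function.Surjective π) (n : ℕ)
    {z : MonoidAlgebra ℤ F} (hz : mapDomainRingHom ℤ π z = 0) :
    ∃ r ∈ π.ker, z - (of ℤ F r - 1) ∈ relAugIdeal π n := by
  let q := (Submodule.mkQ (relAugIdeal π n)).toAddMonoidHom
  have hq : ∀ {x y}, x - y ∈ relAugIdeal π n ↔ q x = q y := fun {x y} =>
    (Submodule.Quotient.eq _).symm
  -- `r ↦ r - 1` is additive on `R` modulo `𝔯𝔣`
  let κ : Additive π.ker →+ MonoidAlgebra ℤ F ⧸ relAugIdeal π n :=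
    AddMonoidHom.mk' (fun r => q (of ℤ F r.toMul - 1)) fun r s => by
      rw [← map_add, ← hq]
      convert of_sub_one_mul_mem_relAugIdeal n r.toMul.2 (s.toMul : F) using 1
      rw [toMul_add, Subgroup.coe_mul, map_mul]; noncomm_ring
  let σ := Function.surjInv hπ
  let f : MonoidAlgebra ℤ F →+ MonoidAlgebra ℤ F := AddMonoidHom.id _ -
    (linExt (of ℤ F ∘ σ)).comp (mapDomainRingHom ℤ π).toAddMonoidHom
  have hfz : f z = z := by simp [f, hz]
  have hf : ∀ a, (q.comp f) (of ℤ F a) ∈ κ.range := fun a => by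
    have hr : a * (σ (π a))⁻¹ ∈ π.ker := by
      rw [MonoidHom.mem_ker, map_mul, map_inv, Function.surjInv_eq hπ, mul_inv_cancel]
    have hfa : f (of ℤ F a) = of ℤ F a - of ℤ F (σ (π a)) := by
      change of ℤ F a - linExt _ (mapDomainRingHom ℤ π (of ℤ F a)) = _
      rw [mapDomainRingHom_of, linExt_of]; rfl
    refine ⟨Additive.ofMul ⟨_, hr⟩, (hq.1 ?_).symm⟩
    convert of_sub_one_mul_mem_relAugIdeal n hr (σ (π a)) using 1
    rw [toMul_ofMul, hfa, mul_sub, sub_mul, one_mul, mul_one, ← map_mul, inv_mul_cancel_right]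
  obtain ⟨r, hr⟩ := map_mem_of_forall_of (q.comp f) κ.range hf z
  exact ⟨r.toMul, r.toMul.2, hq.2 ((hr.trans (congrArg q hfz)).symm)⟩

theorem exists_mem_congrSubgroup_relAugIdeal {π : F →* G} (hπ : Function.Surjective π) {n : ℕ}
    {g : G} (hg : g ∈ D (n + 1) G) : ∃ w ∈ congrSubgroup (relAugIdeal π n), π w = g := by
  obtain ⟨v, rfl⟩ := hπ g
  obtain ⟨x, hx, hxv⟩ := exists_mem_relAugIdeal hπ (mem_D.1 hg)
  obtain ⟨r, hr, hz⟩ := exists_mem_ker_sub_mem_relAugIdeal hπ n (z := of ℤ F v - 1 - x) (by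
    rw [map_sub, map_sub, mapDomainRingHom_of, map_one, hxv, sub_self])
  refine ⟨r⁻¹ * v, inv_mul_mem_congrSubgroup_iff.2 ?_, by
    rw [map_mul, map_inv, MonoidHom.mem_ker.1 hr, inv_one, one_mul]⟩
  convert add_mem hz hx using 1
  abel

end CongrSubgroup

section Uniqueness

open MonoidAlgebra (of mapDomainRingHom)
open scoped commutatorElement IsMulCommutative

variable {F F' G G' : Type*} [Group F] [Group F'] [Group G] [Group G']

theorem smul_mem_of_mem_augIdeal_pow {S A : Type*} [Ring S] [AddCommGroup A] [Module S A]
    (T : MonoidAlgebra ℤ G →+* S) {N : ℕ → AddSubgroup A} (hN₀ : N 0 = ⊤)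
    (hN : ∀ k g, ∀ v ∈ N k, (T (of ℤ G g) - 1) • v ∈ N (k + 1)) {n : ℕ}
    {x : MonoidAlgebra ℤ G} (hx : x ∈ augIdeal G ^ n) (v : A) : T x • v ∈ N n := by
  induction n generalizing x with
  | zero => rw [hN₀]; trivial
  | succ n ih =>
    rw [Ideal.IsTwoSided.pow_succ (I := augIdeal G)] at hx
    refine Submodule.smul_induction_on hx (fun y hy z hz => ?_) fun y z hy hz => by
      simpa only [map_add, add_smul] using add_mem hy hz
    rw [smul_eq_mul, map_mul, mul_smul]
    refine AddSubgroup.closure_induction (p := fun y _ => T y • T z • v ∈ N (n + 1)) ?_ ?_ ?_ ?_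
      (augIdeal_le_closure_of_sub_one hy)
    · rintro _ ⟨g, rfl⟩
      simpa only [map_sub, map_one] using hN n g _ (ih hz)
    · simp only [map_zero, zero_smul, zero_mem]
    · intro y y' _ _ hy hy'
      simpa only [map_add, add_smul] using add_mem hy hy'
    · intro y _ hy
      simpa only [map_neg, neg_smul] using neg_mem hy

theorem exists_conjAction {Q : Type*} [Group Q] (M : Subgroup Q) [M.Normal] [IsMulCommutative M]
    {π : F →* G} (hπ : Function.Surjective π) {φ : F →* Q} (hφ : π.ker ≤ M.comap φ) :
    ∃ ρ : G →* Module.End ℤ (Additive M), ∀ a (v : Additive M),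
      ((ρ (π a) v).toMul : Q) = φ a * v.toMul * (φ a)⁻¹ := by
  let c : F →* MulAut M := (MulAut.conjNormal (H := M)).comp φ
  have hc : π.ker ≤ c.ker := fun r hr => MulEquiv.ext fun v => Subtype.ext <|
    mul_inv_eq_iff_eq_mul.2 (congrArg Subtype.val (mul_comm (⟨φ r, hφ hr⟩ : M) v))
  let ρ : G →* MulAut M := π.liftOfSurjective hπ ⟨c, hc⟩
  have hρ : ∀ a, ρ (π a) = c a := MonoidHom.liftOfRightInverse_comp_apply π _ _ ⟨c, hc⟩
  refine ⟨(Representation.ofMulDistribMulAction (MulAut M) M).comp ρ, fun a v => ?_⟩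
  rw [MonoidHom.comp_apply, hρ]
  rfl

theorem eq_of_mem_congrSubgroup_relAugIdeal {Q : Type*} [Group Q] (M : Subgroup Q) [M.Normal]
    [IsMulCommutative M] {n : ℕ} (hQ : γ (n + 1) Q = ⊥) {π : F →* G}
    (hπ : Function.Surjective π) {φ ψ : F →* Q} (hφ : π.ker ≤ M.comap φ)
    (hφψ : ∀ a, φ a / ψ a ∈ M) {w : F} (hw : w ∈ congrSubgroup (relAugIdeal π n)) :
    φ w = ψ w := by
  obtain ⟨ρ, hρ⟩ := exists_conjAction M hπ hφ
  let T : MonoidAlgebra ℤ G →+* Module.End ℤ (Additive M) := MonoidAlgebra.lift ℤ _ G ρ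
  have hT : ∀ a (v : Additive M), ((T (of ℤ G (π a)) • v).toMul : Q) = φ a * v.toMul * (φ a)⁻¹ :=
    fun a v => by
      rw [← hρ]
      exact congrArg (fun f : Module.End ℤ (Additive M) => ((f v).toMul : Q))
        (MonoidAlgebra.lift_of ρ (π a))
  let δ : F → Additive M := fun a => Additive.ofMul ⟨φ a / ψ a, hφψ a⟩
  have hδ : IsCrossedHom (T.comp (mapDomainRingHom ℤ π)) δ := fun a b => by
    refine Additive.toMul.injective (Subtype.ext ?_)
    rw [add_comm, toMul_add, Subgroup.coe_mul, RingHom.comp_apply, mapDomainRingHom_of, hT]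
    change φ (a * b) / ψ (a * b) = φ a * (φ b / ψ b) * (φ a)⁻¹ * (φ a / ψ a)
    simp only [map_mul, div_eq_mul_inv]; group
  let N (k : ℕ) : AddSubgroup (Additive M) := ((γ (k + 1) Q).subgroupOf M).toAddSubgroup
  have hN : ∀ k g, ∀ v ∈ N k, (T (of ℤ G g) - 1) • v ∈ N (k + 1) := fun k g v hv => by
    obtain ⟨a, rfl⟩ := hπ g
    have hcomm : ((((T (of ℤ G (π a)) - 1) • v).toMul : M) : Q) = ⁅φ a, (v.toMul : Q)⁆ := by
      rw [sub_smul, one_smul, toMul_sub, Subgroup.coe_div, hT, commutatorElement_def,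
        div_eq_mul_inv]
    change ((((T (of ℤ G (π a)) - 1) • v).toMul : M) : Q) ∈ γ (k + 2) Q
    rw [hcomm, ← commutatorElement_inv]
    exact inv_mem (Subgroup.commutator_mem_commutator hv (Subgroup.mem_top _))
  have hN₀ : N 0 = ⊤ := top_le_iff.1 fun v _ => Subgroup.mem_top (v.toMul : Q)
  have hδw : φ w / ψ w ∈ γ (n + 1) Q := hδ.apply_mem_of_sub_one_mem_mul (N := N n)
    (fun x hx b => smul_mem_of_mem_augIdeal_pow T hN₀ hN hx _) hw
  rwa [hQ, Subgroup.mem_bot, div_eq_one] at hδw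

theorem inv_mul_mem_of_mem_congrSubgroup {π : F →* G} (hπ : Function.Surjective π)
    {π' : F' →* G'} {φ ψ : F →* F'} (hφ : π.ker ≤ π'.ker.comap φ)
    (hφψ : π'.comp φ = π'.comp ψ) {n : ℕ} {w : F} (hw : w ∈ congrSubgroup (relAugIdeal π n)) :
    (φ w)⁻¹ * ψ w ∈ ⁅π'.ker, π'.ker⁆ ⊔ γ (n + 1) F' := by
  let K := ⁅π'.ker, π'.ker⁆ ⊔ γ (n + 1) F'
  let q := QuotientGroup.mk' K
  have hq : Function.Surjective q := QuotientGroup.mk'_surjective K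
  have map_eq_bot : ∀ L ≤ K, L.map q = ⊥ := fun L hL => by
    rwa [Subgroup.map_eq_bot_iff, QuotientGroup.ker_mk']
  let M : Subgroup (F' ⧸ K) := π'.ker.map q
  have : M.Normal := Subgroup.Normal.map inferInstance q hq
  have : IsMulCommutative M := by
    rw [← Subgroup.commutator_self_eq_bot_iff, ← Subgroup.map_commutator]
    exact map_eq_bot _ le_sup_left
  have hγ : γ (n + 1) (F' ⧸ K) = ⊥ := by
    rw [← map_eq_bot (γ (n + 1) F') le_sup_right]
    unfold γ
    rw [Subgroup.map_lowerCentralSeries, Subgroup.map_top_of_surjective q hq]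
  refine QuotientGroup.eq.1 (eq_of_mem_congrSubgroup_relAugIdeal M hγ hπ (φ := q.comp φ)
    (ψ := q.comp ψ) (fun r hr => ⟨φ r, hφ hr, rfl⟩) (fun a => ⟨φ a / ψ a, ?_, map_div q _ _⟩) hw)
  exact π'.div_mem_ker_iff.2 (DFunLike.congr_fun hφψ a)

end Uniqueness

section DoubledPresentation

open MonoidAlgebra (of mapDomainRingHom)

variable {X G : Type*} [Group G]

/-- The presentation of `G` on two copies of the generators of the presentation `π`. -/
def doubled (π : FreeGroup X →* G) : FreeGroup (X ⊕ X) →* G :=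
  π.comp (FreeGroup.map (Sum.elim id id))

theorem doubled_map (π : FreeGroup X →* G) {i : X → X ⊕ X} (hi : Sum.elim id id ∘ i = id)
    (w : FreeGroup X) : doubled π (FreeGroup.map i w) = π w := by
  rw [doubled, MonoidHom.comp_apply, FreeGroup.map.comp, hi, FreeGroup.map.id]

theorem map_mem_D_succ_of_inl_inv_mul_inr_mem (π : FreeGroup X →* G) {n : ℕ} {w : FreeGroup X}
    (hw : (FreeGroup.map Sum.inl w)⁻¹ * FreeGroup.map Sum.inr w ∈
      congrSubgroup (relAugIdeal (doubled π) n)) : π w ∈ D (n + 1) G := by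
  let T := mapDomainRingHom ℤ (doubled π)
  obtain ⟨δ, hδ, hδ_of⟩ := exists_isCrossedHom_freeGroup T
    (Sum.elim (fun _ => 0) fun x => of ℤ G (π (FreeGroup.of x)) - 1)
  have hδ_aug : ∀ a, δ a ∈ augIdeal G := fun a => by
    have htop : ⊤ ≤ hδ.comap (augIdeal G) := by
      rw [← FreeGroup.closure_range_of, Subgroup.closure_le]
      rintro _ ⟨x, rfl⟩
      change δ (FreeGroup.of x) ∈ augIdeal G
      rw [hδ_of]
      exact x.rec (fun _ => zero_mem _) fun _ => of_sub_one_mem_augIdeal _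
    exact htop (Subgroup.mem_top a)
  have hδ_inl : δ (FreeGroup.map Sum.inl w) = 0 :=
    congrFun ((hδ.comp _).eq_of_freeGroup (δ' := 0) (fun _ _ => by simp)
      fun x => by simp [hδ_of]) w
  have hδ_inr : δ (FreeGroup.map Sum.inr w) = of ℤ G (π w) - 1 := by
    have hT : T (of ℤ _ (FreeGroup.map Sum.inr w)) = of ℤ G (π w) := by
      rw [mapDomainRingHom_of, doubled_map π rfl]
    rw [← hT]
    exact congrFun ((hδ.comp _).eq_of_freeGroup ((isCrossedHom_of_sub_one T).comp _)
      fun x => by simp [hδ_of, T, doubled]) w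
  have hδ_mem : δ ((FreeGroup.map Sum.inl w)⁻¹ * FreeGroup.map Sum.inr w) ∈ augIdeal G ^ (n + 1) :=
    hδ.apply_mem_of_sub_one_mem_mul (N := (augIdeal G ^ (n + 1)).toAddSubgroup)
      (fun x hx b => Submodule.pow_succ (M := augIdeal G) (n := n) ▸
        Ideal.mul_mem_mul hx (hδ_aug b)) hw
  rw [mem_D, ← hδ_inr, ← sub_zero (δ _), ← hδ_inl, hδ.sub_eq_smul_inv_mul]
  exact Ideal.mul_mem_left _ _ hδ_mem

end DoubledPresentation

section Limits

variable {𝓕 𝓖 : AllPres.{u} ⥤ AddCommGrpCat.{u}} {K : GrpCat.{u} ⥤ AddCommGrpCat.{u}}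
  {G : GrpCat.{u}}

/-- The component at the free presentation `c` of `G` of an element of the limit of `𝓕` over all
free presentations of `G`. -/
noncomputable def limPresπ (𝓕 : AllPres.{u} ⥤ AddCommGrpCat.{u}) (c : Pres G) :
    (limPres 𝓕).obj G ⟶ 𝓕.obj ⟨G, c⟩ :=
  limit.π (fiber G ⋙ 𝓕) c

theorem map_limPresπ {c c' : Pres G} (f : c ⟶ c') (x : (limPres 𝓕).obj G) :
    𝓕.map ((fiber G).map f) (limPresπ 𝓕 c x) = limPresπ 𝓕 c' x :=
  limit.w_apply (fiber G ⋙ 𝓕) f x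

theorem limPresπ_limPresMap (α : 𝓕 ⟶ 𝓖) (x : (limPres 𝓕).obj G) (c : Pres G) :
    limPresπ 𝓖 c ((limPresMap α).app G x) = α.app ⟨G, c⟩ (limPresπ 𝓕 c x) :=
  limMap_π_apply (Functor.whiskerLeft (fiber G) α) c x

/-- The free presentation of `G` on its underlying set; it maps to every other one. -/
abbrev std (G : GrpCat.{u}) : Pres G := stdPres G PUnit.{u + 1}

/-- A morphism from the standard presentation of `G` to an arbitrary one. -/
noncomputable def fromStd (c : Pres G) : std G ⟶ c :=
  Pres.Hom.mk (liftHom ⟨G, c⟩ (MonoidHom.id _)).hom (liftHom ⟨G, c⟩ (MonoidHom.id _)).comm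

theorem limPresπ_std_injective : Function.Injective (limPresπ 𝓕 (std G)) := fun x y h =>
  Concrete.limit_ext (fiber G ⋙ 𝓕) x y fun c => by
    change limPresπ 𝓕 c x = limPresπ 𝓕 c y
    rw [← map_limPresπ (fromStd c), h, map_limPresπ]

theorem mem_range_limPresπ_std_iff {x : 𝓕.obj ⟨G, std G⟩} :
    x ∈ Set.range (limPresπ 𝓕 (std G)) ↔ ∀ (c : Pres G) (φ ψ : std G ⟶ c),
      𝓕.map ((fiber G).map φ) x = 𝓕.map ((fiber G).map ψ) x := by
  constructor
  · rintro ⟨y, rfl⟩ c φ ψ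
    rw [map_limPresπ, map_limPresπ]
  · intro h
    let s : ((fiber G ⋙ 𝓕) ⋙ forget AddCommGrpCat.{u}).sections :=
      ⟨fun c => 𝓕.map ((fiber G).map (fromStd c)) x, fun {c c'} f => by
        change 𝓕.map ((fiber G).map f) (𝓕.map ((fiber G).map (fromStd c)) x) = _
        rw [← ConcreteCategory.comp_apply, ← Functor.map_comp, ← Functor.map_comp]
        exact h c' _ _⟩
    let lim := isLimitOfPreserves (forget AddCommGrpCat.{u}) (limit.isLimit (fiber G ⋙ 𝓕))
    refine ⟨(Types.isLimitEquivSections lim).symm s,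
      (Types.isLimitEquivSections_symm_apply lim s (std G)).trans ?_⟩
    exact (h _ _ (𝟙 _)).trans (ConcreteCategory.congr_hom ((fiber G ⋙ 𝓕).map_id (std G)) x)

theorem limPresMap_injective {ι : 𝓕 ⟶ 𝓖} (hι : ∀ c, Function.Injective (ι.app c)) :
    Function.Injective ((limPresMap ι).app G) := fun x y h =>
  limPresπ_std_injective (hι _ (by rw [← limPresπ_limPresMap, ← limPresπ_limPresMap, h]))

/-- The functor sending a free presentation to the presented group. -/
abbrev presented : AllPres.{u} ⥤ GrpCat.{u} where
  obj c := c.G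
  map f := GrpCat.ofHom f.base

/-- The natural homomorphism out of `lim 𝓕` given by a natural transformation from `𝓕` to a
functor of the presented group. It is defined by the component at the standard presentation, but
all components give the same homomorphism. -/
noncomputable def limPresDesc (α : 𝓕 ⟶ presented ⋙ K) : limPres 𝓕 ⟶ K where
  app G := limPresπ 𝓕 (std G) ≫ α.app ⟨G, std G⟩
  naturality G G' h := by
    let φ : (⟨G, std G⟩ : AllPres) ⟶ ⟨G', std G'⟩ := liftHom ⟨G', std G'⟩ h.hom
    have hφ : (limPres 𝓕).map h ≫ limPresπ 𝓕 (std G') = limPresπ 𝓕 (std G) ≫ 𝓕.map φ :=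
      limPresHom_π 𝓕 h (std G) (std G') φ rfl
    rw [reassoc_of% hφ, Category.assoc, α.naturality]
    rfl

theorem limPresDesc_app (α : 𝓕 ⟶ presented ⋙ K) (c : Pres G) (x : (limPres 𝓕).obj G) :
    (limPresDesc α).app G x = α.app ⟨G, c⟩ (limPresπ 𝓕 c x) := by
  rw [← map_limPresπ (fromStd c), NatTrans.naturality_apply]
  exact (ConcreteCategory.congr_hom (K.map_id G) _).symm

theorem exact_limPresMap_limPresDesc {ι : 𝓕 ⟶ 𝓖} {α : 𝓖 ⟶ presented ⋙ K}
    (hι : ∀ c, Function.Injective (ι.app c)) (hα : ∀ c, Function.Exact (ι.app c) (α.app c)) :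
    Function.Exact ((limPresMap ι).app G) ((limPresDesc α).app G) := fun y => by
  rw [limPresDesc_app α (std G)]
  refine (hα ⟨G, std G⟩ _).trans ⟨?_, ?_⟩
  · rintro ⟨x, hx⟩
    obtain ⟨x, rfl⟩ : x ∈ Set.range (limPresπ 𝓕 (std G)) := by
      refine mem_range_limPresπ_std_iff.2 fun c φ ψ => hι _ ?_
      rw [NatTrans.naturality_apply, NatTrans.naturality_apply, hx, map_limPresπ, map_limPresπ]
    exact ⟨x, limPresπ_std_injective ((limPresπ_limPresMap ι x (std G)).trans hx)⟩
  · rintro ⟨x, rfl⟩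
    exact ⟨_, (limPresπ_limPresMap ι x (std G)).symm⟩

end Limits

section Lift

variable {C : Type*} [Category* C] {H K L : C ⥤ AddCommGrpCat.{u}}

theorem exists_comp_eq_of_range_subset {ι : H ⟶ K} {α : L ⟶ K}
    (hι : ∀ X, Function.Injective (ι.app X))
    (hα : ∀ X, Set.range (α.app X) ⊆ Set.range (ι.app X)) :
    ∃ p : L ⟶ H, ∀ X x, ι.app X (p.app X x) = α.app X x := by
  let p (X : C) : L.obj X →+ H.obj X :=
    (AddMonoidHom.ofInjective (hι X)).symm.toAddMonoidHom.comp
      ((α.app X).hom.codRestrict (ι.app X).hom.range fun x => hα X ⟨x, rfl⟩)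
  have hp : ∀ X x, ι.app X (p X x) = α.app X x := fun X x =>
    congrArg Subtype.val ((AddMonoidHom.ofInjective (hι X)).apply_symm_apply _)
  refine ⟨{ app := fun X => AddCommGrpCat.ofHom (p X), naturality := fun X Y f => ?_ }, hp⟩
  ext x
  refine hι Y ?_
  change ι.app Y (p Y (L.map f x)) = ι.app Y (H.map f (p X x))
  rw [hp, NatTrans.naturality_apply, NatTrans.naturality_apply, hp]

end Lift

section Subquot

variable {E E' : Type u} [Group E] [Group E'] {A N : Subgroup E} [N.Normal]
  {A' N' : Subgroup E'} [N'.Normal]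

theorem subquotMk_eq_iff (h : ⁅A, A⁆ ≤ N) {a b : A} :
    subquotMk A N h a = subquotMk A N h b ↔ (a : E)⁻¹ * b ∈ N :=
  QuotientGroup.eq.trans Subgroup.mem_subgroupOf

theorem subquotMk_eq_zero_iff (h : ⁅A, A⁆ ≤ N) {a : A} :
    subquotMk A N h a = 0 ↔ (a : E) ∈ N :=
  (QuotientGroup.eq_one_iff a).trans Subgroup.mem_subgroupOf

theorem subquotMap_injective (h : ⁅A, A⁆ ≤ N) (h' : ⁅A', A'⁆ ≤ N') (f : E →* E')
    (hA : A ≤ A'.comap f) (hN : N ≤ N'.comap f) (hf : A ⊓ N'.comap f ≤ N) :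
    Function.Injective (subquotMap h h' f hA hN) := by
  refine (injective_iff_map_eq_zero (subquotMap h h' f hA hN).hom).2 fun x hx => ?_
  obtain ⟨a, rfl⟩ := subquotMk_surjective A N h x
  exact (subquotMk_eq_zero_iff h).2 (hf ⟨a.2, (subquotMk_eq_zero_iff h').1 hx⟩)

end Subquot

section LcsQuot

variable {G : Type u} [Group G]

theorem γ_four_le_γ_two (G : Type u) [Group G] : γ 4 G ≤ γ 2 G :=
  Subgroup.lowerCentralSeries_antitone ⊤ (show 1 ≤ 3 by norm_num)

theorem D_four_le_γ_two (G : Type u) [Group G] : D 4 G ≤ γ 2 G :=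
  (D_antitone G (show 2 ≤ 4 by norm_num)).trans (D_two_le G)

theorem allDenom_le_comap_π (c : Pres G) : allDenom c ≤ (γ 4 G).comap c.π := by
  refine sup_le ((Subgroup.commutator_le_left c.R c.R).trans fun r hr => ?_) (map_γ_le 4 c.π)
  rw [Subgroup.mem_comap, MonoidHom.mem_ker.1 hr]
  exact one_mem (γ 4 G)

theorem R_inf_allDenom_le_relDenom (c : Pres G) : c.R ⊓ allDenom c ≤ relDenom c := by
  rintro x ⟨hxR, hx⟩
  obtain ⟨y, hy, z, hz, rfl⟩ := Subgroup.mem_sup_of_normal_left.1 hx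
  have hyR : y ∈ c.R := Subgroup.commutator_le_left c.R c.R hy
  exact Subgroup.mul_mem_sup hy ⟨(Subgroup.mul_mem_cancel_left _ hyR).1 hxR, hz⟩

/-- The functor `G ↦ γ₂(G) / γ₄(G)`, in which the fourth dimension quotient is a subfunctor. -/
def lcsQuot : GrpCat.{u} ⥤ AddCommGrpCat.{u} where
  obj G := subquot (γ 2 G) (γ 4 G) (commutator_γ_two G)
  map f := subquotMap _ _ f.hom (map_γ_le 2 f.hom) (map_γ_le 4 f.hom)
  map_id _ := subquot_hom_ext fun _ => rfl
  map_comp _ _ := subquot_hom_ext fun _ => rfl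

/-- The inclusion of `D₄(G) / γ₄(G)` in `γ₂(G) / γ₄(G)`. -/
noncomputable def dimToLcs : dimQuot.{u} ⟶ lcsQuot.{u} where
  app G := subquotMap (D_four_comm G) (commutator_γ_two G) (MonoidHom.id G)
    (D_four_le_γ_two G) le_rfl
  naturality _ _ _ := subquot_hom_ext fun _ => rfl

/-- The natural map `γ₂(F) / (γ₂(R)γ₄(F)) → γ₂(G) / γ₄(G)` induced by the projection. -/
def allToLcs : allQuot.{u} ⟶ presented ⋙ lcsQuot.{u} where
  app c := subquotMap (allDenom_comm c.pres) (commutator_γ_two c.G) c.pres.π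
    (map_γ_le 2 c.pres.π) (allDenom_le_comap_π c.pres)
  naturality _ _ f := subquot_hom_ext fun w =>
    congrArg (subquotMk _ _ _) (Subtype.ext (DFunLike.congr_fun f.comm w.1))

theorem inclQuot_app_injective (c : AllPres.{u}) : Function.Injective (inclQuot.app c) :=
  subquotMap_injective (relDenom_comm c.pres) (allDenom_comm c.pres) (MonoidHom.id _) inf_le_right
    (sup_le_sup_left inf_le_right _) fun _ hw => R_inf_allDenom_le_relDenom c.pres ⟨hw.1.1, hw.2⟩

theorem dimToLcs_app_injective (G : GrpCat.{u}) : Function.Injective (dimToLcs.app G) :=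
  subquotMap_injective (D_four_comm G) (commutator_γ_two G) (MonoidHom.id G) (D_four_le_γ_two G)
    le_rfl fun _ hg => hg.2

theorem exact_inclQuot_allToLcs (c : AllPres.{u}) :
    Function.Exact (inclQuot.app c) (allToLcs.app c) := fun y => by
  obtain ⟨w, rfl⟩ := subquotMk_surjective _ _ _ y
  refine (subquotMk_eq_zero_iff (commutator_γ_two c.G)).trans ⟨fun hw => ?_, ?_⟩
  · have hmap : (γ 4 c.pres.F).map c.pres.π = γ 4 c.G := by
      unfold γ
      rw [Subgroup.map_lowerCentralSeries, Subgroup.map_top_of_surjective _ c.pres.surj]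
    obtain ⟨v, hv, hvw⟩ : ∃ v ∈ γ 4 c.pres.F, c.pres.π v = c.pres.π w := hmap.ge hw
    have hwv : (w : c.pres.F) * v⁻¹ ∈ γ 2 c.pres.F :=
      (γ 2 c.pres.F).mul_mem w.2 ((γ 2 c.pres.F).inv_mem (γ_four_le_γ_two _ hv))
    refine ⟨subquotMk _ _ _ ⟨w * v⁻¹, ?_, hwv⟩,
      (subquotMk_eq_iff (allDenom_comm c.pres)).2 (le_sup_right (a := ⁅c.pres.R, c.pres.R⁆) ?_)⟩
    · exact c.pres.π.mem_ker.2 (by rw [map_mul, map_inv, hvw, mul_inv_cancel])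
    · simpa using hv
  · rintro ⟨x, hx⟩
    obtain ⟨v, rfl⟩ := subquotMk_surjective _ _ _ x
    have hvw : (v : c.pres.F)⁻¹ * w ∈ allDenom c.pres :=
      (subquotMk_eq_iff (allDenom_comm c.pres)).1 hx
    have hπ := allDenom_le_comap_π c.pres hvw
    rwa [Subgroup.mem_comap, map_mul, map_inv, MonoidHom.mem_ker.1 v.2.1, inv_one, one_mul] at hπ

theorem dimToLcs_dimClass (G : GrpCat.{u}) (g : D 4 G) :
    dimToLcs.app G (dimClass G g) =
      subquotMk (γ 2 G) (γ 4 G) (commutator_γ_two G) ⟨g, D_four_le_γ_two G g.2⟩ :=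
  rfl

theorem subquotMk_mem_range_dimToLcs_iff {G : GrpCat.{u}} (v : γ 2 G) :
    subquotMk (γ 2 G) (γ 4 G) (commutator_γ_two G) v ∈ Set.range (dimToLcs.app G) ↔
      (v : G) ∈ D 4 G := by
  refine ⟨?_, fun hv => ⟨dimClass G ⟨v, hv⟩, dimToLcs_dimClass G ⟨v, hv⟩⟩⟩
  rintro ⟨x, hx⟩
  obtain ⟨g, rfl⟩ := subquotMk_surjective _ _ _ x
  have hgv : (g : G)⁻¹ * v ∈ γ 4 G := (subquotMk_eq_iff (commutator_γ_two G)).1 hx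
  exact (Subgroup.mul_mem_cancel_left _ (inv_mem g.2)).1 (γ_le_D 4 hgv)

end LcsQuot

section Range

variable {G : GrpCat.{u}}

/-- The free presentation of `G` on two copies of its underlying set. -/
def doubledStd (G : GrpCat.{u}) : Pres G where
  F := FreeGroup ((G × PUnit.{u + 1}) ⊕ (G × PUnit.{u + 1}))
  π := doubled (std G).π
  surj g := ((std G).surj g).imp' (FreeGroup.map Sum.inl) fun w hw =>
    (doubled_map (std G).π rfl w).trans hw

/-- The morphism from the standard presentation to its double given by a choice of a copy for
each generator. -/
def doubledStdHom (i : G × PUnit.{u + 1} → (G × PUnit.{u + 1}) ⊕ (G × PUnit.{u + 1}))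
    (hi : Sum.elim id id ∘ i = id) : std G ⟶ doubledStd G :=
  Pres.Hom.mk (FreeGroup.map i) (MonoidHom.ext (doubled_map (std G).π hi))

theorem std_π_mem_D_four {w : (std G).F}
    (hw : (FreeGroup.map Sum.inl w)⁻¹ * FreeGroup.map Sum.inr w ∈ allDenom (doubledStd G)) :
    (std G).π w ∈ D 4 G :=
  map_mem_D_succ_of_inl_inv_mul_inr_mem (n := 3) (std G).π
    (commutator_ker_sup_γ_le_congrSubgroup (doubled (std G).π) 3 hw)

theorem range_limPresDesc_allToLcs :
    Set.range ((limPresDesc allToLcs).app G) = Set.range (dimToLcs.app G) := by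
  refine Set.Subset.antisymm ?_ ?_
  · rintro _ ⟨x, rfl⟩
    obtain ⟨w, hw⟩ := subquotMk_surjective _ _ _ (limPresπ allQuot (std G) x)
    have hincl (i) (hi) : allQuot.map ((fiber G).map (doubledStdHom i hi)) (subquotMk _ _ _ w) =
        limPresπ allQuot (doubledStd G) x := by
      rw [hw, map_limPresπ]
    rw [limPresDesc_app allToLcs (std G), ← hw]
    exact (subquotMk_mem_range_dimToLcs_iff _).2 (std_π_mem_D_four
      ((subquotMk_eq_iff (allDenom_comm (doubledStd G))).1
        ((hincl Sum.inl rfl).trans (hincl Sum.inr rfl).symm)))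
  · rintro _ ⟨y, rfl⟩
    obtain ⟨⟨g, hg⟩, rfl⟩ := subquotMk_surjective _ _ _ y
    obtain ⟨w, hw, rfl⟩ := exists_mem_congrSubgroup_relAugIdeal (std G).surj hg
    have hw₂ : w ∈ γ 2 (std G).F := congrSubgroup_relAugIdeal_le_γ_two _ three_ne_zero hw
    obtain ⟨x, hx⟩ : allClass (std G) ⟨w, hw₂⟩ ∈ Set.range (limPresπ allQuot (std G)) :=
      mem_range_limPresπ_std_iff.2 fun c φ ψ => (subquotMk_eq_iff (allDenom_comm c)).2
        (inv_mul_mem_of_mem_congrSubgroup (std G).surj (AllPres.map_R_le ((fiber G).map φ))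
          (φ.comm.trans ψ.comm.symm) hw)
    exact ⟨x, (limPresDesc_app allToLcs (std G) x).trans (congrArg _ hx)⟩

end Range

end PresLim

theorem theorem6p1 :
    ∃ p : limPres allQuot.{u} ⟶ dimQuot.{u},
      (∀ G : GrpCat.{u},
        Function.Injective ((limPresMap inclQuot).app G) ∧
        Function.Exact ((limPresMap inclQuot).app G) (p.app G) ∧
        Function.Surjective (p.app G)) ∧
      (∀ (G : GrpCat.{u}) (x : (limPres allQuot).obj G) (c : Pres G) (w : γ 2 c.F),
        limit.π (fiber G ⋙ allQuot) c x = allClass c w →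
          ∃ hg : c.π w ∈ D 4 G, p.app G x = dimClass G ⟨c.π w, hg⟩) := by
  obtain ⟨p, hp⟩ := exists_comp_eq_of_range_subset (α := limPresDesc allToLcs)
    dimToLcs_app_injective fun _ => range_limPresDesc_allToLcs.subset
  have hexact (G : GrpCat.{u}) := exact_limPresMap_limPresDesc (G := G) inclQuot_app_injective
    exact_inclQuot_allToLcs
  refine ⟨p, fun G => ⟨limPresMap_injective inclQuot_app_injective, fun x => ?_, fun y => ?_⟩,
    fun G x c w hw => ?_⟩
  · rw [← hexact G x, ← hp, ← map_eq_zero_iff (dimToLcs.app G).hom (dimToLcs_app_injective G)]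
  · obtain ⟨x, hx⟩ := range_limPresDesc_allToLcs.superset ⟨y, rfl⟩
    exact ⟨x, dimToLcs_app_injective G ((hp G x).trans hx)⟩
  · let v : γ 2 G := ⟨c.π w, map_γ_le 2 c.π w.2⟩
    have hpx : dimToLcs.app G (p.app G x) = subquotMk _ _ (commutator_γ_two G) v := by
      rw [hp, limPresDesc_app allToLcs c]
      exact congrArg (allToLcs.app ⟨G, c⟩) hw
    have hg : c.π w ∈ D 4 G := (subquotMk_mem_range_dimToLcs_iff v).1 ⟨p.app G x, hpx⟩
    refine ⟨hg, dimToLcs_app_injective G ?_⟩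
    rw [hpx, dimToLcs_dimClass]
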